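/- For a word $x=x_1x_2\cdots x_n$ of nonnegative integers let $\mathrm{asc}(x)$ and $\mathrm{des}(x)$ be the numbers of places $j$ with $1\le j<n$ and $x_j<x_{j+1}$, respectively $x_j>x_{j+1}$. An *ascent sequence* is such a word with $x_1=0$ and $x_i\le \mathrm{asc}(x_1\cdots x_{i-1})+1$ for $1<i\le n$. It is *restricted* if $x_i\ge \max(x_1,\dots,x_{i-1})-1$ for all $1<i\le n$; let $\mathcal R_n$ be the set of restricted ascent sequences of length $n$. A word avoids a pattern $p$ if it has no subsequence whose letters are in the same relative order (with equal letters corresponding to equal letters) as those of $p$. Let $\mathcal A_{021}(n)$ be the set of ascent sequences of length $n$ avoiding $021$, and $\mathcal S_n(231)$ the set of permutations of $1,2,\dots,n$, written as words, that avoid $231$. A letter $x_i$ of an ascent sequence is *maximal* if $i=1$ or $x_i=\mathrm{asc}(x_1\cdots x_{i-1})+1$. Let $x$ be a nonempty restricted ascent sequence, let $x_i$ be its rightmost maximal letter, and let $k\ge 0$ be the largest integer with $x_i=x_{i+1}=\dots=x_{i+k}$. Call the maximal letter *repeated* if $k\ge1$. Write $x=LmR$ as a concatenation, where $m$ is the letter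 in place $i+k$; let $\ell$ be the length of $L$, and let $\overline R$ be $R$ with its first letter subtracted from each of its letters (empty if $R$ is empty). For a restricted ascent sequence $x$ and an interval $[a,b]$ of integers with as many elements as $x$ has letters, define a word $\omega(x,[a,b])$ recursively: it is empty if $x$ is empty, and for $x=LmR$ as above, with juxtaposition by $\oplus$, $$\omega(LmR,[a,b])=\begin{cases} a\oplus\omega(L,[a+1,a+\ell])\oplus\omega(\overline R,[a+\ell+1,b]) & \text{if the rightmost maximal letter is repeated},\\ (a+\ell)\oplus\omega(L,[a,a+\ell-1])\oplus\omega(\overline R,[a+\ell+1,b]) & \text{otherwise.}\end{cases}$$ Put $\phi(x)=\omega(x,[1,n])$ for $x\in\mathcal R_n$. **Theorem.** For every $n\ge 0$, the map $\phi$ is a bijection from $\mathcal R_n$ to $\mathcal S_n(231)$, and $\mathrm{asc}(x)=\mathrm{des}(\phi(x))$ for every $x\in\mathcal R_n$. Moreover, for every $n\ge1$ and every $k\ge0$, the number of $x\in\mathcal A_{021}(n)$ with $\mathrm{asc}(x)=k$ and the number of $x\in\mathcal R_n$ with $\mathrm{asc}(x)=k$ are both equal to the Narayana number $N(n,k+1)$,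 where $N(n,j)=\frac1n\binom nj\binom n{j-1}$ for $j\ge1$. -/

import Mathlib

/-- The number of ascents of a word: positions `i` with `x i < x (i + 1)`. -/
def asc : List ℕ → ℕ
  | [] => 0
  | [_] => 0
  | a :: b :: l => (if a < b then 1 else 0) + asc (b :: l)

/-- The number of descents of a word: positions `i` with `x i > x (i + 1)`. -/
def des : List ℕ → ℕ
  | [] => 0
  | [_] => 0
  | a :: b :: l => (if b < a then 1 else 0) + des (b :: l)

/-- Ascent sequences: the first letter is `0`, and every later letter is at most one more than
the number of ascents of the prefix before it (positions are counted from `0`). -/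
def IsAscentSeq (x : List ℕ) : Prop :=
  ∀ (i : ℕ) (hi : i < x.length), x[i] ≤ if i = 0 then 0 else asc (x.take i) + 1

/-- Restricted ascent sequences: ascent sequences in which every letter is at least `M - 1`,
where `M` is the maximum of the letters before it; equivalently, every earlier letter `x[j]`
satisfies `x[j] - 1 ≤ x[i]`. -/
def IsRestrictedAscentSeq (x : List ℕ) : Prop :=
  IsAscentSeq x ∧
    ∀ (i j : ℕ) (hi : i < x.length) (hj : j < i), x[j] ≤ x[i] + 1

/-- The word `x` contains the pattern `p`: some subsequence of `x` is order isomorphic to `p`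
(in particular, equal letters of `p` correspond to equal letters of `x`). -/
def ContainsPattern (p x : List ℕ) : Prop :=
  ∃ f : Fin p.length ↪o Fin x.length,
    ∀ i j : Fin p.length, x.get (f i) < x.get (f j) ↔ p.get i < p.get j

/-- The set of restricted ascent sequences of length `n`. -/
def restrictedAscentSeqs (n : ℕ) : Set (List ℕ) :=
  {x | x.length = n ∧ IsRestrictedAscentSeq x}

/-- The set of ascent sequences of length `n` that avoid the pattern `p`. -/
def ascentSeqsAvoiding (p : List ℕ) (n : ℕ) : Set (List ℕ) :=
  {x | x.length = n ∧ IsAscentSeq x ∧ ¬ ContainsPattern p x}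

/-- The permutations of `1, 2, …, n`, written as words (one-line notation), that avoid the
pattern `p`. -/
def permsAvoiding (p : List ℕ) (n : ℕ) : Set (List ℕ) :=
  {w | w.Perm (List.range' 1 n) ∧ ¬ ContainsPattern p w}

/-- The letter in place `i` (counted from `0`) is maximal: it is as large as an ascent sequence
allows in that place. The initial letter is maximal by definition. -/
def IsMaximalAt (x : List ℕ) (i : ℕ) : Prop :=
  i < x.length ∧ (i = 0 ∨ x.getD i 0 = asc (x.take i) + 1)

instance (x : List ℕ) : DecidablePred (IsMaximalAt x) :=
  fun i => inferInstanceAs (Decidable (i < x.length ∧ (i = 0 ∨ x.getD i 0 = asc (x.take i) + 1)))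

/-- The place of the rightmost maximal letter of a nonempty word. -/
def rightmostMaximal (x : List ℕ) : ℕ :=
  Nat.findGreatest (IsMaximalAt x) (x.length - 1)

/-- The number of letters that directly follow the rightmost maximal letter and repeat it. -/
def numRepetitions (x : List ℕ) : ℕ :=
  ((x.drop (rightmostMaximal x + 1)).takeWhile
    (fun c => decide (c = x.getD (rightmostMaximal x) 0))).length

/-- The place of the last repetition of the rightmost maximal letter. -/
def lastRepetition (x : List ℕ) : ℕ :=
  rightmostMaximal x + numRepetitions x

theorem lastRepetition_lt {x : List ℕ} (hx : x ≠ []) : lastRepetition x < x.length := by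
  have h0 : 0 < x.length := List.length_pos_iff.mpr hx
  have h1 : rightmostMaximal x ≤ x.length - 1 := Nat.findGreatest_le _
  have h2 : numRepetitions x ≤ x.length - (rightmostMaximal x + 1) := by
    unfold numRepetitions
    refine le_trans (List.takeWhile_sublist _).length_le ?_
    simp
  unfold lastRepetition
  omega

/-- Subtract the first letter of a word from each of its letters. -/
def reduceByHead (r : List ℕ) : List ℕ :=
  r.map (fun c => c - r.headD 0)

/-- The recursive map `ω(x, [a, b])`. The interval `[a, b]` has as many elements as `x` has
letters, so it is given by its left end `a` alone. For nonempty `x = L m R`, with `m` the last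
repetition of the rightmost maximal letter and `ℓ` the length of `L`, the value is
`a ⊕ ω(L, [a + 1, a + ℓ]) ⊕ ω(R', [a + ℓ + 1, b])` if the maximal letter is repeated and
`(a + ℓ) ⊕ ω(L, [a, a + ℓ - 1]) ⊕ ω(R', [a + ℓ + 1, b])` otherwise, where `R'` is `R` with its
first letter subtracted from each of its letters. -/
def omegaMap (x : List ℕ) (a : ℕ) : List ℕ :=
  if _hx : x = [] then []
  else
    if 0 < numRepetitions x then
      a :: (omegaMap (x.take (lastRepetition x)) (a + 1) ++
        omegaMap (reduceByHead (x.drop (lastRepetition x + 1))) (a + lastRepetition x + 1))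
    else
      (a + lastRepetition x) :: (omegaMap (x.take (lastRepetition x)) a ++
        omegaMap (reduceByHead (x.drop (lastRepetition x + 1))) (a + lastRepetition x + 1))
termination_by x.length
decreasing_by
  all_goals
    have h := lastRepetition_lt _hx
    simp only [reduceByHead, List.length_take, List.length_map, List.length_drop]
    omega

/-- The map `φ(x) = ω(x, [1, n])`, where `n` is the length of `x`. -/
def phi (x : List ℕ) : List ℕ := omegaMap x 1

/-- The Narayana number `N(n, k) = (1 / n) * C(n, k) * C(n, k - 1)` for `n, k ≥ 1`, where
`N(n, 0) = 0`. -/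
def narayana (n k : ℕ) : ℚ :=
  if k = 0 then 0 else (1 / (n : ℚ)) * (n.choose k : ℚ) * (n.choose (k - 1) : ℚ)

/-!
Binary trees with `n` nodes code all three families of words.

A permutation avoiding 231 has the form `v A B` with all letters of `A` below `v` and all letters
of `B` above `v`, and any two 231-avoiding words `A`, `B` may occur. This is the binary tree
recursion (`treeWord`, `bijOn_treeWord`), and descents correspond to nodes with a nonempty left
subtree (`leftEdges`, `des_treeWord`).

A nonempty restricted ascent sequence either is constant or has the form `L m ⋯ m R'`, where `L` is
nonempty, `m = asc L + 1` is the rightmost maximal letter, and `R'` is a restricted ascent sequence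
`R` raised by `m - 1`; conversely all `L`, `R` and all multiplicities of `m` may occur
(`blockWord`, `IsRestrictedAscentSeq.eq_replicate_or_eq_blockWord`). The map `ω` sends such a word
with a single `m` to the permutation whose tree has the subtrees of `L` and `R`, and each further
`m` prepends the smallest letter, that is, adds a root with an empty left subtree
(`omegaMap_blockWord_zero`, `omegaMap_blockWord_succ`). Hence there is a bijection `treeSeq` from
trees to restricted ascent sequences with `phi ∘ treeSeq = treeWord`, and `phi` is a bijection that
sends ascents to descents.

For the count, cutting a tree at its root gives a quadratic equation for the generating function
`F` of binary trees by `leftEdges`. Differentiating the square of `2 x t F + x - x t - 1` turns it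
into a three-term recurrence in the number of nodes, which the explicit Narayana numbers satisfy as
well (`coeff_recurrence_of_quadratic`, `coeff_narayanaPoly`).

An ascent sequence avoids 021 exactly if its nonzero letters increase weakly. The number of ways to
extend a prefix depends only on the difference `s` between `asc + 1` and the largest letter (or `1`,
if that is larger) and on whether the last letter is zero. With `G = (F - 1) / x` and
`Λ = (1 - x) G`, the generating functions of the extensions are `G Λ ^ s` after a zero and
`G F Λ ^ (s - 1)` after a nonzero letter; both families satisfy the recursion that adding a letter
gives, because `Λ - 1 = x t G F` (`slackSeries_sub_one`, `extensionPoly_eq`). The word `0` has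
`s = 0`, so its extensions are counted by `G`, and the 021-avoiding ascent sequences by `F`.
-/

open BinaryTree

/-! ### Patterns of length three -/

theorem containsPattern_triple {p q r : ℕ} {x : List ℕ} :
    ContainsPattern [p, q, r] x ↔ ∃ a b c, [a, b, c].Sublist x ∧
      (a < b ↔ p < q) ∧ (b < a ↔ q < p) ∧ (a < c ↔ p < r) ∧ (c < a ↔ r < p) ∧
      (b < c ↔ q < r) ∧ (c < b ↔ r < q) := by
  constructor
  · rintro ⟨f, hf⟩
    refine ⟨x.get (f 0), x.get (f 1), x.get (f 2), ?_, hf 0 1, hf 1 0, hf 0 2, hf 2 0, hf 1 2,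
      hf 2 1⟩
    refine List.sublist_iff_exists_fin_orderEmbedding_get_eq.2 ⟨f, fun i => ?_⟩
    match i with
    | ⟨0, _⟩ => rfl
    | ⟨1, _⟩ => rfl
    | ⟨2, _⟩ => rfl
  · rintro ⟨a, b, c, hs, h1, h2, h3, h4, h5, h6⟩
    obtain ⟨f, hf⟩ := List.sublist_iff_exists_fin_orderEmbedding_get_eq.1 hs
    refine ⟨f, fun i j => ?_⟩
    rw [← hf i, ← hf j]
    match i, j with
    | ⟨0, _⟩, ⟨0, _⟩ => simp
    | ⟨0, _⟩, ⟨1, _⟩ => exact h1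
    | ⟨0, _⟩, ⟨2, _⟩ => exact h3
    | ⟨1, _⟩, ⟨0, _⟩ => exact h2
    | ⟨1, _⟩, ⟨1, _⟩ => simp
    | ⟨1, _⟩, ⟨2, _⟩ => exact h5
    | ⟨2, _⟩, ⟨0, _⟩ => exact h4
    | ⟨2, _⟩, ⟨1, _⟩ => exact h6
    | ⟨2, _⟩, ⟨2, _⟩ => simp

theorem containsPattern_231 {x : List ℕ} :
    ContainsPattern [2, 3, 1] x ↔ ∃ a b c, [a, b, c].Sublist x ∧ c < a ∧ a < b := by
  rw [containsPattern_triple]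
  refine exists_congr fun a => exists_congr fun b => exists_congr fun c =>
    and_congr_right fun _ => ?_
  simp only [Nat.reduceLT, iff_true, iff_false]
  omega

theorem containsPattern_021 {x : List ℕ} :
    ContainsPattern [0, 2, 1] x ↔ ∃ a b c, [a, b, c].Sublist x ∧ a < c ∧ c < b := by
  rw [containsPattern_triple]
  refine exists_congr fun a => exists_congr fun b => exists_congr fun c =>
    and_congr_right fun _ => ?_
  simp only [Nat.reduceLT, iff_true, iff_false]
  omega

/-! ### Ascents and descents of concatenations -/

theorem asc_append_cons_cons (l : List ℕ) (a b : ℕ) (r : List ℕ) :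
    asc (l ++ a :: b :: r) = asc (l ++ [a]) + asc (a :: b :: r) := by
  induction l with
  | nil => simp [asc]
  | cons c l ih =>
    cases l with
    | nil => simp [asc]
    | cons d l =>
      simp only [List.cons_append, asc] at ih ⊢
      omega

theorem asc_snoc (l : List ℕ) (a b : ℕ) :
    asc (l ++ [a] ++ [b]) = asc (l ++ [a]) + if a < b then 1 else 0 := by
  have h := asc_append_cons_cons l a b []
  simpa [asc] using h

theorem asc_le_asc_snoc (l : List ℕ) (b : ℕ) : asc l ≤ asc (l ++ [b]) := by
  rcases List.eq_nil_or_concat' l with rfl | ⟨l, a, rfl⟩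
  · simp [asc]
  · rw [asc_snoc]; omega

theorem asc_map_add (l : List ℕ) (s : ℕ) : asc (l.map (· + s)) = asc l := by
  induction l with
  | nil => rfl
  | cons a l ih =>
    cases l with
    | nil => rfl
    | cons b l => simp only [List.map_cons, asc] at ih ⊢; simp [ih]

theorem des_append_of_lt {l r : List ℕ} (h : ∀ a ∈ l, ∀ b ∈ r, a < b) :
    des (l ++ r) = des l + des r := by
  induction l with
  | nil => simp [des]
  | cons c l ih =>
    have ih := ih fun a ha => h a (List.mem_cons_of_mem _ ha)
    cases l with
    | nil =>
      cases r with
      | nil => simp [des]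
      | cons d r =>
        have := h c (by simp) d (by simp)
        simp [des]; omega
    | cons d l =>
      simp only [List.cons_append, des] at ih ⊢
      omega

/-! ### Binary trees and permutations avoiding 231 -/

/-- The word over `[a, a + n - 1]` coded by a binary tree with `n` nodes: its first letter `v` is
determined by the size of the left subtree, which codes the letters below `v`, and the right
subtree codes the letters above `v`. -/
def treeWord : BinaryTree Unit → ℕ → List ℕ
  | .nil, _ => []
  | .node _ A B, a =>
    (a + A.numNodes) :: (treeWord A a ++ treeWord B (a + A.numNodes + 1))

/-- The number of nodes of a binary tree that have a nonempty left subtree. -/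
def leftEdges : BinaryTree Unit → ℕ
  | .nil => 0
  | .node _ A B => (if A = .nil then 0 else 1) + leftEdges A + leftEdges B

theorem length_treeWord (t : BinaryTree Unit) (a : ℕ) : (treeWord t a).length = t.numNodes := by
  induction t generalizing a with
  | nil => rfl
  | node _ A B hA hB => simp [treeWord, hA, hB]

theorem treeWord_perm (t : BinaryTree Unit) (a : ℕ) :
    (treeWord t a).Perm (List.range' a t.numNodes) := by
  induction t generalizing a with
  | nil => rfl
  | node _ A B hA hB =>
    have h : List.range' a (A.numNodes + B.numNodes + 1) =
        List.range' a A.numNodes ++ (a + A.numNodes) ::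
          List.range' (a + A.numNodes + 1) B.numNodes := by
      rw [← List.range'_succ, List.range'_append_1, add_assoc]
    simp only [treeWord, numNodes]
    rw [h]
    exact (((hA a).append (hB _)).cons _).trans List.perm_middle.symm

theorem mem_treeWord {t : BinaryTree Unit} {a c : ℕ} :
    c ∈ treeWord t a ↔ a ≤ c ∧ c < a + t.numNodes := by
  rw [(treeWord_perm t a).mem_iff, List.mem_range'_1]

theorem treeWord_eq_nil {t : BinaryTree Unit} {a : ℕ} : treeWord t a = [] ↔ t = .nil := by
  cases t <;> simp [treeWord]

theorem treeWord_injective (a : ℕ) : Function.Injective (treeWord · a) := by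
  intro s t h
  simp only at h
  induction s generalizing a t with
  | nil => exact (treeWord_eq_nil.1 h.symm).symm
  | node _ A B hA hB =>
    cases t with
    | nil => simp [treeWord] at h
    | node _ A' B' =>
      simp only [treeWord, List.cons.injEq] at h
      obtain ⟨h1, h2⟩ := h
      have hn : A.numNodes = A'.numNodes := by omega
      obtain ⟨h3, h4⟩ := List.append_inj h2 (by simp [length_treeWord, hn])
      rw [hn] at h4
      rw [hA a h3, hB _ h4]

theorem des_treeWord (t : BinaryTree Unit) (a : ℕ) : des (treeWord t a) = leftEdges t := by
  induction t generalizing a with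
  | nil => rfl
  | node _ A B hA hB =>
    have hlt : ∀ c ∈ treeWord A a, ∀ d ∈ treeWord B (a + A.numNodes + 1), c < d := by
      intro c hc d hd
      rw [mem_treeWord] at hc hd
      omega
    by_cases h : A = .nil
    · subst h
      have hlt' : ∀ c ∈ [a], ∀ d ∈ treeWord B (a + 1), c < d := by
        intro c hc d hd
        rw [mem_treeWord] at hd
        simp at hc
        omega
      have := des_append_of_lt hlt'
      simp only [List.cons_append, List.nil_append] at this
      simp [treeWord, leftEdges, this, hB, des]
    · have hA' := hA a
      have h' := des_append_of_lt hlt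
      rw [hA', hB] at h'
      obtain ⟨c, l, hcl⟩ := List.exists_cons_of_ne_nil (mt treeWord_eq_nil.1 h : treeWord A a ≠ [])
      have hc : c < a + A.numNodes := (mem_treeWord.1 (by rw [hcl]; simp : c ∈ treeWord A a)).2
      rw [hcl] at h'
      simp only [treeWord, leftEdges, hcl, List.cons_append, des, hc, h, if_true, if_false] at h' ⊢
      omega

theorem treeWord_avoids_231 (t : BinaryTree Unit) (a : ℕ) :
    ¬ ContainsPattern [2, 3, 1] (treeWord t a) := by
  rw [containsPattern_231]
  induction t generalizing a with
  | nil => simp [treeWord]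
  | node _ A B hA hB =>
    rintro ⟨p, q, r, hs, hrp, hpq⟩
    rw [treeWord] at hs
    have key : ∀ l : List ℕ, l.Sublist (treeWord A a ++ treeWord B (a + A.numNodes + 1)) →
        ∃ l₁ l₂, l = l₁ ++ l₂ ∧ l₁.Sublist (treeWord A a) ∧
          l₂.Sublist (treeWord B (a + A.numNodes + 1)) := fun l hl => List.sublist_append_iff.1 hl
    have memA : ∀ {l : List ℕ} {c}, l.Sublist (treeWord A a) → c ∈ l → c < a + A.numNodes :=
      fun h hc => (mem_treeWord.1 (h.subset hc)).2
    have memB : ∀ {l : List ℕ} {c}, l.Sublist (treeWord B (a + A.numNodes + 1)) → c ∈ l →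
        a + A.numNodes + 1 ≤ c := fun h hc => (mem_treeWord.1 (h.subset hc)).1
    rcases List.sublist_cons_iff.1 hs with hs | ⟨l, hl, hs⟩
    · obtain ⟨l₁, l₂, hl, h₁, h₂⟩ := key _ hs
      match l₁, hl with
      | [], hl =>
        rw [List.nil_append] at hl; subst hl
        exact hB _ ⟨p, q, r, h₂, hrp, hpq⟩
      | [u], hl =>
        simp at hl; obtain ⟨rfl, rfl⟩ := hl
        have := memA h₁ (by simp : p ∈ [p]); have := memB h₂ (by simp : r ∈ [q, r]); omega
      | [u, v], hl =>
        simp at hl; obtain ⟨rfl, rfl, rfl⟩ := hl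
        have := memA h₁ (by simp : p ∈ [p, q]); have := memB h₂ (by simp : r ∈ [r]); omega
      | [u, v, w], hl =>
        simp at hl; obtain ⟨rfl, rfl, rfl, rfl⟩ := hl
        exact hA _ ⟨p, q, r, h₁, hrp, hpq⟩
      | _ :: _ :: _ :: _ :: _, hl => simp at hl
    · simp only [List.cons.injEq] at hl
      obtain ⟨rfl, rfl⟩ := hl
      obtain ⟨l₁, l₂, hl, h₁, h₂⟩ := key _ hs
      match l₁, hl with
      | [], hl =>
        rw [List.nil_append] at hl; subst hl
        have := memB h₂ (by simp : r ∈ [q, r]); omega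
      | u :: l₁, hl =>
        simp at hl; obtain ⟨rfl, -⟩ := hl
        have := memA h₁ (by simp : q ∈ q :: l₁); omega

/-- If a 231-avoiding permutation starts with `v`, then in the rest `r` no letter above `v` comes
before a letter below `v`, so `r` splits into its smaller and its larger letters. -/
theorem filter_lt_append_filter_gt {v : ℕ} {r : List ℕ} (hv : v ∉ r)
    (h : ∀ b c, [b, c].Sublist r → c < v → b < v) :
    r.filter (· < v) ++ r.filter (v < ·) = r := by
  induction r with
  | nil => rfl
  | cons d r ih =>
    have ih := ih (fun h => hv (List.mem_cons_of_mem _ h)) fun b c hs => h b c (hs.cons d)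
    have hd : d ≠ v := fun h => hv (h ▸ List.mem_cons_self)
    by_cases hdv : d < v
    · have : ¬ v < d := by omega
      simp [hdv, this, ih]
    · have hvd : v < d := by omega
      have hr : ∀ c ∈ r, v < c := by
        intro c hc
        have hcv : c ≠ v := fun h => hv (h ▸ List.mem_cons_of_mem _ hc)
        have := h d c (List.Sublist.cons_cons d (List.singleton_sublist.2 hc))
        omega
      have h1 : r.filter (· < v) = [] := by
        rw [List.filter_eq_nil_iff]; intro c hc; have := hr c hc; simp; omega
      have h2 : r.filter (v < ·) = r := by
        rw [List.filter_eq_self]; intro c hc; simpa using hr c hc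
      simp [hdv, hvd, h1, h2]

theorem exists_treeWord_eq (n : ℕ) (a : ℕ) (w : List ℕ) (hw : w.Perm (List.range' a n))
    (hav : ¬ ContainsPattern [2, 3, 1] w) :
    ∃ t : BinaryTree Unit, t.numNodes = n ∧ treeWord t a = w := by
  induction n using Nat.strong_induction_on generalizing a w with
  | _ n ih =>
    rw [containsPattern_231] at hav
    cases w with
    | nil =>
      have := hw.length_eq
      simp at this
      exact ⟨.nil, by simp [← this], rfl⟩
    | cons v r =>
      have hnd : (v :: r).Nodup := hw.nodup_iff.2 List.nodup_range'
      have hmem : ∀ c, c ∈ v :: r ↔ a ≤ c ∧ c < a + n := fun c => by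
        rw [hw.mem_iff, List.mem_range'_1]
      have hv := (hmem v).1 List.mem_cons_self
      have hvr : v ∉ r := (List.nodup_cons.1 hnd).1
      have hr := filter_lt_append_filter_gt hvr fun b c hs hc => by
        have hbv : b ≠ v := fun h => hvr (h ▸ hs.subset (by simp))
        by_contra hb
        exact hav ⟨v, b, c, hs.cons_cons v, hc, by omega⟩
      have hmem' : ∀ c, c ≠ v → (c ∈ r ↔ a ≤ c ∧ c < a + n) := fun c hc => by
        rw [← hmem c, List.mem_cons]; simp [hc]
      have hrn : r.Nodup := (List.nodup_cons.1 hnd).2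
      have sub : ∀ s : List ℕ, s.Sublist r → ¬ ContainsPattern [2, 3, 1] s := by
        intro s hs hc
        rw [containsPattern_231] at hc
        obtain ⟨p, q, u, hpqu, h⟩ := hc
        exact hav ⟨p, q, u, (hpqu.trans hs).cons v, h⟩
      have hA : (r.filter (· < v)).Perm (List.range' a (v - a)) := by
        refine (List.perm_ext_iff_of_nodup (hrn.filter _) List.nodup_range').2 fun c => ?_
        rw [List.mem_filter, List.mem_range'_1, decide_eq_true_iff]
        by_cases hc : c = v
        · subst hc; simp; omega
        · rw [hmem' c hc]; omega
      have hB : (r.filter (v < ·)).Perm (List.range' (v + 1) (a + n - (v + 1))) := by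
        refine (List.perm_ext_iff_of_nodup (hrn.filter _) List.nodup_range').2 fun c => ?_
        rw [List.mem_filter, List.mem_range'_1, decide_eq_true_iff]
        by_cases hc : c = v
        · subst hc; simp
        · rw [hmem' c hc]; omega
      obtain ⟨A, hAn, hAw⟩ := ih (v - a) (by omega) a _ hA (sub _ List.filter_sublist)
      obtain ⟨B, hBn, hBw⟩ := ih (a + n - (v + 1)) (by omega) (v + 1) _ hB
        (sub _ List.filter_sublist)
      refine ⟨.node () A B, ?_, ?_⟩
      · simp only [numNodes]; omega
      · have : a + A.numNodes = v := by omega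
        rw [treeWord, this, hAw, hBw, hr]

theorem bijOn_treeWord (n : ℕ) :
    Set.BijOn (treeWord · 1) {t | t.numNodes = n} (permsAvoiding [2, 3, 1] n) := by
  refine ⟨?_, (treeWord_injective 1).injOn, ?_⟩
  · rintro t rfl
    exact ⟨treeWord_perm t 1, treeWord_avoids_231 t 1⟩
  · rintro w ⟨hw, hav⟩
    exact exists_treeWord_eq n 1 w hw hav

/-! ### Ascent sequences built letter by letter -/

theorem isAscentSeq_nil : IsAscentSeq [] := fun i hi => absurd hi (by simp)

theorem isAscentSeq_snoc {y : List ℕ} {b : ℕ} :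
    IsAscentSeq (y ++ [b]) ↔ IsAscentSeq y ∧ b ≤ if y = [] then 0 else asc y + 1 := by
  constructor
  · intro h
    refine ⟨fun i hi => ?_, ?_⟩
    · have := h i (by simp; omega)
      rwa [List.getElem_append_left hi, List.take_append_of_le_length hi.le] at this
    · have := h y.length (by simp)
      simpa using this
  · rintro ⟨h, hb⟩ i hi
    rcases Nat.lt_or_ge i y.length with hy | hy
    · rw [List.getElem_append_left hy, List.take_append_of_le_length hy.le]
      exact h i hy
    · have : i = y.length := by simp at hi; omega
      subst this
      simpa using hb

theorem IsAscentSeq.take {x : List ℕ} (hx : IsAscentSeq x) (j : ℕ) : IsAscentSeq (x.take j) := by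
  intro i hi
  rw [List.length_take, lt_min_iff] at hi
  simpa [List.take_take, min_eq_left hi.1.le] using hx i hi.2

theorem isRestrictedAscentSeq_nil : IsRestrictedAscentSeq [] :=
  ⟨isAscentSeq_nil, fun i _ hi => absurd hi (by simp)⟩

theorem isRestrictedAscentSeq_snoc {y : List ℕ} {b : ℕ} :
    IsRestrictedAscentSeq (y ++ [b]) ↔ IsRestrictedAscentSeq y ∧
      (b ≤ if y = [] then 0 else asc y + 1) ∧ ∀ c ∈ y, c ≤ b + 1 := by
  unfold IsRestrictedAscentSeq
  rw [isAscentSeq_snoc]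
  constructor
  · rintro ⟨⟨h1, h2⟩, h3⟩
    refine ⟨⟨h1, fun i j hi hj => ?_⟩, h2, fun c hc => ?_⟩
    · have := h3 i j (by simp; omega) hj
      rwa [List.getElem_append_left hi, List.getElem_append_left (by omega)] at this
    · obtain ⟨j, hj, rfl⟩ := List.getElem_of_mem hc
      have := h3 y.length j (by simp) hj
      rw [List.getElem_append_left hj] at this
      simpa using this
  · rintro ⟨⟨h1, h2⟩, h3, h4⟩
    refine ⟨⟨h1, h3⟩, fun i j hi hj => ?_⟩
    rcases Nat.lt_or_ge i y.length with hy | hy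
    · rw [List.getElem_append_left hy, List.getElem_append_left (by omega)]
      exact h2 i j hy hj
    · have : i = y.length := by simp at hi; omega
      subst this
      rw [List.getElem_append_left hj]
      simpa using h4 _ (List.getElem_mem hj)

theorem IsAscentSeq.le_asc {x : List ℕ} (hx : IsAscentSeq x) : ∀ c ∈ x, c ≤ asc x := by
  induction x using List.reverseRecOn with
  | nil => simp
  | append_singleton y b ih =>
    obtain ⟨hy, hb⟩ := isAscentSeq_snoc.1 hx
    intro c hc
    rcases List.mem_append.1 hc with hc | hc
    · exact (ih hy c hc).trans (asc_le_asc_snoc _ _)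
    · obtain rfl := List.mem_singleton.1 hc
      rcases List.eq_nil_or_concat' y with rfl | ⟨l, a, rfl⟩
      · simpa [asc] using hb
      · have ha := ih hy a (by simp)
        rw [if_neg (by simp)] at hb
        rw [asc_snoc]
        split <;> omega

theorem IsAscentSeq.getD_zero {x : List ℕ} (hx : IsAscentSeq x) : x.getD 0 0 = 0 := by
  cases x with
  | nil => rfl
  | cons a l => exact Nat.le_zero.1 (hx 0 (by simp))

/-- The next letter of an ascent sequence creates an ascent if it is maximal. -/
theorem IsAscentSeq.asc_snoc_maximal {x : List ℕ} (hx : IsAscentSeq x) (hne : x ≠ []) :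
    asc (x ++ [asc x + 1]) = asc x + 1 := by
  rcases List.eq_nil_or_concat' x with rfl | ⟨l, a, rfl⟩
  · exact absurd rfl hne
  · have := hx.le_asc a (by simp)
    rw [asc_snoc, if_pos (by omega)]

theorem asc_replicate (k c : ℕ) : asc (List.replicate k c) = 0 := by
  induction k with
  | zero => rfl
  | succ k ih =>
    cases k with
    | zero => rfl
    | succ k => simpa [List.replicate_succ, asc] using ih

/-! ### Decomposition at the rightmost maximal letter -/

/-- The word `L m ⋯ m R'` with `m = asc L + 1` repeated `k + 1` times, and `R'` obtained from `R`
by adding `m - 1` to every letter. If `L` is nonempty and `L` and `R` are restricted ascent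
sequences, this is the restricted ascent sequence whose rightmost maximal letter is `m`. -/
def blockWord (L : List ℕ) (k : ℕ) (R : List ℕ) : List ℕ :=
  L ++ List.replicate (k + 1) (asc L + 1) ++ R.map (· + asc L)

theorem length_blockWord (L : List ℕ) (k : ℕ) (R : List ℕ) :
    (blockWord L k R).length = L.length + (k + 1) + R.length := by
  simp [blockWord]; omega

theorem blockWord_snoc (L : List ℕ) (k : ℕ) (R : List ℕ) (b : ℕ) :
    blockWord L k (R ++ [b]) = blockWord L k R ++ [b + asc L] := by
  simp [blockWord]

theorem blockWord_succ_nil (L : List ℕ) (k : ℕ) :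
    blockWord L (k + 1) [] = blockWord L k [] ++ [asc L + 1] := by
  simp [blockWord, List.replicate_succ' (n := k + 1)]

theorem blockWord_ne_nil (L : List ℕ) (k : ℕ) (R : List ℕ) : blockWord L k R ≠ [] := by
  simp [blockWord]

theorem asc_blockWord_nil {L : List ℕ} (hL : IsAscentSeq L) (hne : L ≠ []) (k : ℕ) :
    asc (blockWord L k []) = asc L + 1 := by
  induction k with
  | zero => simpa [blockWord] using hL.asc_snoc_maximal hne
  | succ k ih =>
    rw [blockWord_succ_nil]
    have : blockWord L k [] = L ++ List.replicate k (asc L + 1) ++ [asc L + 1] := by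
      simp [blockWord, List.replicate_succ']
    rw [this] at ih ⊢
    rw [asc_snoc, ih]
    simp

theorem asc_blockWord {L R : List ℕ} (hL : IsAscentSeq L) (hne : L ≠ []) (hR : IsAscentSeq R)
    (k : ℕ) : asc (blockWord L k R) = asc L + 1 + asc R := by
  have key : ∀ c r, R = c :: r → asc (blockWord L k (c :: r)) = asc L + 1 + asc (c :: r) := by
    rintro c r rfl
    have hc : c = 0 := by simpa using hR.getD_zero
    subst hc
    have h1 : blockWord L k (0 :: r) = L ++ List.replicate k (asc L + 1) ++
        (asc L + 1) :: (asc L) :: r.map (· + asc L) := by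
      simp [blockWord, List.replicate_succ']
    have h2 : L ++ List.replicate k (asc L + 1) ++ [asc L + 1] = blockWord L k [] := by
      simp [blockWord, List.replicate_succ']
    have h3 := asc_map_add (0 :: r) (asc L)
    simp only [List.map_cons, zero_add] at h3
    rw [h1, asc_append_cons_cons, h2, asc_blockWord_nil hL hne, asc, h3]
    simp
  cases R with
  | nil => simpa [asc] using asc_blockWord_nil hL hne k
  | cons c r => exact key c r rfl

theorem isRestrictedAscentSeq_blockWord {L R : List ℕ} (hL : IsRestrictedAscentSeq L)
    (hne : L ≠ []) (hR : IsRestrictedAscentSeq R) (k : ℕ) :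
    IsRestrictedAscentSeq (blockWord L k R) := by
  have mem : ∀ {k R c}, IsAscentSeq R → c ∈ blockWord L k R →
      c ≤ asc L + 1 ∨ ∃ d ∈ R, c = d + asc L := by
    intro k R c hR hc
    simp only [blockWord, List.mem_append, List.mem_replicate, List.mem_map] at hc
    rcases hc with (hc | hc) | ⟨d, hd, rfl⟩
    · exact .inl ((hL.1.le_asc c hc).trans (by omega))
    · exact .inl hc.2.le
    · exact .inr ⟨d, hd, rfl⟩
  induction R using List.reverseRecOn with
  | nil =>
    induction k with
    | zero =>
      have : blockWord L 0 [] = L ++ [asc L + 1] := by simp [blockWord]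
      rw [this, isRestrictedAscentSeq_snoc]
      refine ⟨hL, by simp [hne], fun c hc => ?_⟩
      have := hL.1.le_asc c hc
      omega
    | succ k ih =>
      rw [blockWord_succ_nil, isRestrictedAscentSeq_snoc]
      refine ⟨ih, ?_, fun c hc => ?_⟩
      · rw [if_neg (blockWord_ne_nil _ _ _), asc_blockWord_nil hL.1 hne]
        omega
      · rcases mem isAscentSeq_nil hc with h | ⟨d, hd, -⟩
        · omega
        · simp at hd
  | append_singleton R b ih =>
    obtain ⟨hR', hb, hmax⟩ := isRestrictedAscentSeq_snoc.1 hR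
    rw [blockWord_snoc, isRestrictedAscentSeq_snoc]
    refine ⟨ih hR', ?_, fun c hc => ?_⟩
    · rw [if_neg (blockWord_ne_nil _ _ _), asc_blockWord hL.1 hne hR'.1]
      split at hb <;> omega
    · rcases mem hR'.1 hc with h | ⟨d, hd, rfl⟩
      · omega
      · have := hmax d hd
        omega

theorem isRestrictedAscentSeq_replicate_zero (k : ℕ) :
    IsRestrictedAscentSeq (List.replicate k 0) := by
  induction k with
  | zero => exact isRestrictedAscentSeq_nil
  | succ k ih =>
    rw [List.replicate_succ', isRestrictedAscentSeq_snoc]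
    refine ⟨ih, Nat.zero_le _, fun c hc => ?_⟩
    have := (List.mem_replicate.1 hc).2
    omega

/-- A nonempty restricted ascent sequence either is constant or is a block word. -/
theorem IsRestrictedAscentSeq.eq_replicate_or_eq_blockWord {x : List ℕ}
    (hx : IsRestrictedAscentSeq x) :
    (∃ k, x = List.replicate k 0) ∨ ∃ L k R, IsRestrictedAscentSeq L ∧ L ≠ [] ∧
      IsRestrictedAscentSeq R ∧ x = blockWord L k R := by
  induction x using List.reverseRecOn with
  | nil => exact .inl ⟨0, rfl⟩
  | append_singleton y b ih =>
    obtain ⟨hy, hb, hmax⟩ := isRestrictedAscentSeq_snoc.1 hx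
    by_cases hyn : y = []
    · subst hyn
      refine .inl ⟨1, ?_⟩
      simp at hb
      simp [hb]
    rw [if_neg hyn] at hb
    by_cases hbm : b = asc y + 1
    · refine .inr ⟨y, 0, [], hy, hyn, isRestrictedAscentSeq_nil, ?_⟩
      simp [blockWord, hbm]
    rcases ih hy with ⟨k, rfl⟩ | ⟨L, k, R, hL, hne, hR, rfl⟩
    · rw [asc_replicate] at hb hbm
      obtain rfl : b = 0 := by omega
      exact .inl ⟨k + 1, List.replicate_succ'.symm⟩
    · have hb1 := hmax (asc L + 1) (by simp [blockWord])
      rw [asc_blockWord hL.1 hne hR.1] at hb hbm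
      by_cases hRn : R = []
      · subst hRn
        simp only [asc] at hb hbm
        by_cases hbL : b = asc L
        · refine .inr ⟨L, k, [0], hL, hne, isRestrictedAscentSeq_replicate_zero 1, ?_⟩
          rw [← List.nil_append [0], blockWord_snoc, hbL, zero_add]
        · obtain rfl : b = asc L + 1 := by omega
          exact .inr ⟨L, k + 1, [], hL, hne, hR, (blockWord_succ_nil _ _).symm⟩
      · refine .inr ⟨L, k, R ++ [b - asc L], hL, hne, ?_, ?_⟩
        · rw [isRestrictedAscentSeq_snoc, if_neg hRn]
          refine ⟨hR, by omega, fun c hc => ?_⟩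
          have := hmax (c + asc L) (by
            simp only [blockWord, List.mem_append, List.mem_map]
            exact .inr ⟨c, hc, rfl⟩)
          omega
        · rw [blockWord_snoc]
          congr 2
          omega

theorem rightmostMaximal_blockWord {L R : List ℕ} (hL : IsAscentSeq L) (hne : L ≠ [])
    (hR : IsAscentSeq R) (k : ℕ) : rightmostMaximal (blockWord L k R) = L.length := by
  have hlen := length_blockWord L k R
  have hpos : 0 < L.length := List.length_pos_iff.2 hne
  unfold rightmostMaximal
  rw [Nat.findGreatest_eq_iff]
  refine ⟨by omega, fun _ => ⟨by omega, .inr ?_⟩, fun i hi hi' => ?_⟩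
  · have : blockWord L k R =
        L ++ (asc L + 1) :: (List.replicate k (asc L + 1) ++ R.map (· + asc L)) := by
      simp [blockWord, List.replicate_succ]
    rw [this]
    simp
  · rintro ⟨hi'', h | h⟩
    · omega
    rcases Nat.lt_or_ge i (L.length + (k + 1)) with hik | hik
    · have htake : (blockWord L k R).take i = blockWord L (i - L.length - 1) [] := by
        have : i - L.length - 1 + 1 = i - L.length := by omega
        rw [blockWord, List.append_assoc, List.take_append, List.take_of_length_le hi.le,
          List.take_append, List.take_replicate, blockWord, this]
        have h2 : min (i - L.length) (k + 1) = i - L.length := by omega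
        have h3 : i - L.length - (k + 1) = 0 := by omega
        simp [h2, h3]
      have hget : (blockWord L k R).getD i 0 = asc L + 1 := by
        rw [blockWord, List.getD_append _ _ _ _ (by simp; omega),
          List.getD_append_right _ _ _ _ hi.le]
        simp [show i - L.length < k + 1 by omega]
      rw [htake, hget, asc_blockWord_nil hL hne] at h
      omega
    · obtain ⟨j, rfl⟩ := Nat.exists_eq_add_of_le hik
      have hj : j < R.length := by omega
      have hl : (L ++ List.replicate (k + 1) (asc L + 1)).length = L.length + (k + 1) := by simp
      have htake : (blockWord L k R).take (L.length + (k + 1) + j) = blockWord L k (R.take j) := by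
        rw [blockWord, ← hl, List.take_length_add_append, blockWord, List.map_take]
      have hget : (blockWord L k R).getD (L.length + (k + 1) + j) 0 = R[j] + asc L := by
        rw [blockWord, List.getD_append_right _ _ _ _ (by simp), hl]
        simp [List.getD_eq_getElem?_getD, hj]
      have hRj : IsAscentSeq (R.take j) := hR.take j
      have := hR j hj
      rw [htake, hget, asc_blockWord hL hne hRj] at h
      split at this <;> omega

theorem numRepetitions_blockWord {L R : List ℕ} (hL : IsAscentSeq L) (hne : L ≠ [])
    (hR : IsAscentSeq R) (k : ℕ) : numRepetitions (blockWord L k R) = k := by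
  have hx : blockWord L k R =
      L ++ (asc L + 1) :: (List.replicate k (asc L + 1) ++ R.map (· + asc L)) := by
    simp [blockWord, List.replicate_succ]
  unfold numRepetitions
  rw [rightmostMaximal_blockWord hL hne hR, hx]
  have hd : (L ++ (asc L + 1) :: (List.replicate k (asc L + 1) ++ R.map (· + asc L))).drop
      (L.length + 1) = List.replicate k (asc L + 1) ++ R.map (· + asc L) := by
    simp [List.drop_append]
  have hg : (L ++ (asc L + 1) :: (List.replicate k (asc L + 1) ++ R.map (· + asc L))).getD
      L.length 0 = asc L + 1 := by simp
  rw [hd, hg, List.takeWhile_append_of_pos (by simp)]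
  cases R with
  | nil => simp
  | cons c r =>
    have hc : c = 0 := by simpa using hR.getD_zero
    simp [hc]

theorem rightmostMaximal_replicate_zero (k : ℕ) : rightmostMaximal (List.replicate k 0) = 0 := by
  unfold rightmostMaximal
  rw [Nat.findGreatest_eq_zero_iff]
  rintro i hi - ⟨hlt, h | h⟩
  · omega
  · simp at h

theorem numRepetitions_replicate_zero (k : ℕ) :
    numRepetitions (List.replicate (k + 1) 0) = k := by
  unfold numRepetitions
  rw [rightmostMaximal_replicate_zero, ← List.append_nil (List.drop _ _),
    List.takeWhile_append_of_pos (by simp)]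
  simp

theorem lastRepetition_blockWord {L R : List ℕ} (hL : IsAscentSeq L) (hne : L ≠ [])
    (hR : IsAscentSeq R) (k : ℕ) : lastRepetition (blockWord L k R) = L.length + k := by
  rw [lastRepetition, rightmostMaximal_blockWord hL hne hR, numRepetitions_blockWord hL hne hR]

theorem lastRepetition_replicate_zero (k : ℕ) :
    lastRepetition (List.replicate (k + 1) 0) = k := by
  rw [lastRepetition, rightmostMaximal_replicate_zero, numRepetitions_replicate_zero, zero_add]

/-! ### The map `ω` on block words -/

theorem omegaMap_nil (a : ℕ) : omegaMap [] a = [] := by rw [omegaMap]; simp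

theorem reduceByHead_map_add {R : List ℕ} (hR : IsAscentSeq R) (s : ℕ) :
    reduceByHead (R.map (· + s)) = R := by
  cases R with
  | nil => rfl
  | cons c r =>
    have hc : c = 0 := by simpa using hR.getD_zero
    subst hc
    simp [reduceByHead, Function.comp_def]

theorem drop_blockWord (L : List ℕ) (k : ℕ) (R : List ℕ) :
    (blockWord L k R).drop (L.length + k + 1) = R.map (· + asc L) := by
  have : (L ++ List.replicate (k + 1) (asc L + 1)).length = L.length + k + 1 := by simp; omega
  rw [blockWord, ← this, List.drop_left]

theorem take_blockWord_zero (L R : List ℕ) :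
    (blockWord L 0 R).take L.length = L := by
  rw [blockWord, List.append_assoc, List.take_left]

theorem take_blockWord_succ (L : List ℕ) (k : ℕ) (R : List ℕ) :
    (blockWord L (k + 1) R).take (L.length + (k + 1)) = blockWord L k [] := by
  have h : blockWord L (k + 1) R = blockWord L k [] ++ (asc L + 1) :: R.map (· + asc L) := by
    simp [blockWord, List.replicate_succ' (n := k + 1)]
  have hl : (blockWord L k []).length = L.length + (k + 1) := by simp [length_blockWord]
  rw [h, ← hl, List.take_left]

theorem omegaMap_blockWord_zero {L R : List ℕ} (hL : IsAscentSeq L) (hne : L ≠ [])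
    (hR : IsAscentSeq R) (a : ℕ) : omegaMap (blockWord L 0 R) a =
      (a + L.length) :: (omegaMap L a ++ omegaMap R (a + L.length + 1)) := by
  rw [omegaMap, dif_neg (blockWord_ne_nil _ _ _), numRepetitions_blockWord hL hne hR,
    if_neg (by simp), lastRepetition_blockWord hL hne hR, drop_blockWord L 0,
    reduceByHead_map_add hR]
  simp only [add_zero, take_blockWord_zero]

theorem omegaMap_blockWord_succ' {L R : List ℕ} (hL : IsAscentSeq L) (hne : L ≠ [])
    (hR : IsAscentSeq R) (k a : ℕ) : omegaMap (blockWord L (k + 1) R) a =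
      a :: (omegaMap (blockWord L k []) (a + 1) ++
        omegaMap R (a + (L.length + (k + 1)) + 1)) := by
  rw [omegaMap, dif_neg (blockWord_ne_nil _ _ _), numRepetitions_blockWord hL hne hR,
    if_pos (by simp), lastRepetition_blockWord hL hne hR, drop_blockWord,
    reduceByHead_map_add hR, take_blockWord_succ]

/-- The part `R` after the rightmost maximal letter contributes a final segment of its own, however
often that letter is repeated. -/
theorem omegaMap_blockWord_append {L R : List ℕ} (hL : IsAscentSeq L) (hne : L ≠ [])
    (hR : IsAscentSeq R) (k a : ℕ) : omegaMap (blockWord L k R) a =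
      omegaMap (blockWord L k []) a ++ omegaMap R (a + L.length + k + 1) := by
  cases k with
  | zero =>
    rw [omegaMap_blockWord_zero hL hne hR, omegaMap_blockWord_zero hL hne isAscentSeq_nil]
    simp [omegaMap_nil]
  | succ k =>
    rw [omegaMap_blockWord_succ' hL hne hR, omegaMap_blockWord_succ' hL hne isAscentSeq_nil]
    simp [omegaMap_nil, add_assoc]

/-- One more repetition of the rightmost maximal letter prepends the smallest letter. -/
theorem omegaMap_blockWord_succ {L R : List ℕ} (hL : IsAscentSeq L) (hne : L ≠ [])
    (hR : IsAscentSeq R) (k a : ℕ) : omegaMap (blockWord L (k + 1) R) a =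
      a :: omegaMap (blockWord L k R) (a + 1) := by
  rw [omegaMap_blockWord_succ' hL hne hR, omegaMap_blockWord_append hL hne hR]
  congr 4
  omega

theorem omegaMap_replicate_zero_succ (k a : ℕ) :
    omegaMap (List.replicate (k + 1) 0) a = a :: omegaMap (List.replicate k 0) (a + 1) := by
  rw [omegaMap, dif_neg (by simp), numRepetitions_replicate_zero, lastRepetition_replicate_zero]
  cases k with
  | zero => simp [omegaMap_nil, reduceByHead]
  | succ k => simp [omegaMap_nil, reduceByHead, List.take_replicate]

/-! ### Restricted ascent sequences coded by binary trees -/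

/-- Repeat the rightmost maximal letter once more. The empty word becomes the word `0`. -/
def repeatMaximal (x : List ℕ) : List ℕ :=
  x.take (lastRepetition x) ++ x.getD (lastRepetition x) 0 :: x.drop (lastRepetition x)

theorem repeatMaximal_replicate_zero (k : ℕ) :
    repeatMaximal (List.replicate k 0) = List.replicate (k + 1) 0 := by
  cases k with
  | zero => rfl
  | succ k =>
    rw [repeatMaximal, lastRepetition_replicate_zero]
    simp [List.replicate_succ' (n := k + 1), List.replicate_succ' (n := k)]

theorem repeatMaximal_blockWord {L R : List ℕ} (hL : IsAscentSeq L) (hne : L ≠ [])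
    (hR : IsAscentSeq R) (k : ℕ) :
    repeatMaximal (blockWord L k R) = blockWord L (k + 1) R := by
  have h : blockWord L k R = (L ++ List.replicate k (asc L + 1)) ++
      (asc L + 1) :: R.map (· + asc L) := by
    simp [blockWord, List.replicate_succ']
  have hl : (L ++ List.replicate k (asc L + 1)).length = L.length + k := by simp
  rw [repeatMaximal, lastRepetition_blockWord hL hne hR, h, ← hl, List.take_left, List.drop_left]
  simp [blockWord, List.replicate_succ']

theorem IsRestrictedAscentSeq.repeatMaximal {x : List ℕ} (hx : IsRestrictedAscentSeq x) :
    IsRestrictedAscentSeq (repeatMaximal x) ∧ asc (_root_.repeatMaximal x) = asc x ∧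
      (_root_.repeatMaximal x).length = x.length + 1 ∧
      ∀ a, omegaMap (_root_.repeatMaximal x) a = a :: omegaMap x (a + 1) := by
  rcases hx.eq_replicate_or_eq_blockWord with ⟨k, rfl⟩ | ⟨L, k, R, hL, hne, hR, rfl⟩
  · rw [repeatMaximal_replicate_zero]
    exact ⟨isRestrictedAscentSeq_replicate_zero _, by simp [asc_replicate], by simp,
      omegaMap_replicate_zero_succ k⟩
  · rw [repeatMaximal_blockWord hL.1 hne hR.1]
    refine ⟨isRestrictedAscentSeq_blockWord hL hne hR _, ?_, ?_,
      omegaMap_blockWord_succ hL.1 hne hR.1 k⟩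
    · rw [asc_blockWord hL.1 hne hR.1, asc_blockWord hL.1 hne hR.1]
    · simp only [length_blockWord]; omega

/-- The restricted ascent sequence coded by a binary tree: a node with an empty left subtree
repeats the rightmost maximal letter, and a node with a nonempty left subtree creates it. -/
def treeSeq : BinaryTree Unit → List ℕ
  | .nil => []
  | .node _ .nil B => repeatMaximal (treeSeq B)
  | .node _ (.node u A A') B => blockWord (treeSeq (.node u A A')) 0 (treeSeq B)

theorem treeSeq_node {A : BinaryTree Unit} (hA : A ≠ .nil) (B : BinaryTree Unit) :
    treeSeq (.node () A B) = blockWord (treeSeq A) 0 (treeSeq B) := by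
  cases A with
  | nil => exact absurd rfl hA
  | node u A A' => rw [treeSeq]

theorem treeSeq_spec (t : BinaryTree Unit) :
    IsRestrictedAscentSeq (treeSeq t) ∧ (treeSeq t).length = t.numNodes ∧
      asc (treeSeq t) = leftEdges t ∧ ∀ a, omegaMap (treeSeq t) a = treeWord t a := by
  induction t with
  | nil => exact ⟨isRestrictedAscentSeq_nil, rfl, rfl, omegaMap_nil⟩
  | node _ A B hA hB =>
    obtain ⟨hB1, hB2, hB3, hB4⟩ := hB
    by_cases h : A = .nil
    · subst h
      obtain ⟨h1, h2, h3, h4⟩ := hB1.repeatMaximal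
      rw [treeSeq]
      refine ⟨h1, by simp [h3, hB2], by simp [h2, hB3, leftEdges], fun a => ?_⟩
      simp [h4, hB4, treeWord]
    · obtain ⟨hA1, hA2, hA3, hA4⟩ := hA
      have hne : treeSeq A ≠ [] := by
        intro h0
        rw [h0] at hA2
        cases A with
        | nil => exact h rfl
        | node => simp at hA2
      rw [treeSeq_node h]
      refine ⟨isRestrictedAscentSeq_blockWord hA1 hne hB1 0, ?_, ?_, fun a => ?_⟩
      · rw [length_blockWord, hA2, hB2, numNodes]; omega
      · rw [asc_blockWord hA1.1 hne hB1.1, hA3, hB3, leftEdges, if_neg h]; omega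
      · rw [omegaMap_blockWord_zero hA1.1 hne hB1.1, hA4, hB4, hA2, treeWord]

theorem treeSeq_injective : Function.Injective treeSeq := fun s t h =>
  treeWord_injective 1 (by simp only [← (treeSeq_spec _).2.2.2, h])

theorem exists_treeSeq_eq {x : List ℕ} (hx : IsRestrictedAscentSeq x) :
    ∃ t, treeSeq t = x := by
  induction h : x.length using Nat.strong_induction_on generalizing x with
  | _ n ih =>
    rcases hx.eq_replicate_or_eq_blockWord with ⟨k, rfl⟩ | ⟨L, k, R, hL, hne, hR, rfl⟩
    · clear ih h hx
      induction k with
      | zero => exact ⟨.nil, rfl⟩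
      | succ k ih =>
        obtain ⟨t, ht⟩ := ih
        exact ⟨.node () .nil t, by rw [treeSeq, ht, repeatMaximal_replicate_zero]⟩
    · rw [length_blockWord] at h
      obtain ⟨A, hA⟩ := ih _ (by omega) hL rfl
      obtain ⟨B, hB⟩ := ih _ (by omega) hR rfl
      clear ih h hx
      induction k with
      | zero =>
        refine ⟨.node () A B, ?_⟩
        have hAn : A ≠ .nil := by
          rintro rfl
          exact hne hA.symm
        rw [treeSeq_node hAn, hA, hB]
      | succ k ih =>
        obtain ⟨t, ht⟩ := ih
        exact ⟨.node () .nil t, by rw [treeSeq, ht, repeatMaximal_blockWord hL.1 hne hR.1]⟩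

theorem bijOn_treeSeq (n : ℕ) :
    Set.BijOn treeSeq {t | t.numNodes = n} (restrictedAscentSeqs n) := by
  refine ⟨?_, treeSeq_injective.injOn, ?_⟩
  · rintro t rfl
    exact ⟨(treeSeq_spec t).2.1, (treeSeq_spec t).1⟩
  · rintro x ⟨rfl, hx⟩
    obtain ⟨t, rfl⟩ := exists_treeSeq_eq hx
    exact ⟨t, (treeSeq_spec t).2.1.symm, rfl⟩

theorem phi_treeSeq (t : BinaryTree Unit) : phi (treeSeq t) = treeWord t 1 :=
  (treeSeq_spec t).2.2.2 1

theorem bijOn_phi (n : ℕ) :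
    Set.BijOn phi (restrictedAscentSeqs n) (permsAvoiding [2, 3, 1] n) := by
  have h : Set.BijOn (phi ∘ treeSeq) {t | t.numNodes = n} (permsAvoiding [2, 3, 1] n) :=
    (bijOn_treeWord n).congr fun t _ => (phi_treeSeq t).symm
  rwa [Set.bijOn_comp_iff treeSeq_injective.injOn, (bijOn_treeSeq n).image_eq] at h

theorem asc_eq_des_phi {x : List ℕ} (hx : IsRestrictedAscentSeq x) : asc x = des (phi x) := by
  obtain ⟨t, rfl⟩ := exists_treeSeq_eq hx
  rw [phi_treeSeq, des_treeWord, (treeSeq_spec t).2.2.1]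

/-! ### The generating function of binary trees -/

/-- The polynomial `∑ t ^ (leftEdges T)` over all binary trees `T` with `n` nodes. -/
noncomputable def narayanaPoly (n : ℕ) : Polynomial ℚ :=
  ∑ T ∈ treesOfNumNodesEq n, Polynomial.X ^ leftEdges T

/-- The generating function `F` of the polynomials `narayanaPoly n`. -/
noncomputable def narayanaSeries : PowerSeries (Polynomial ℚ) := PowerSeries.mk narayanaPoly

/-- The variable `t` that marks ascents, as a constant power series. -/
noncomputable abbrev ascVar : PowerSeries (Polynomial ℚ) := PowerSeries.C Polynomial.X

theorem narayanaPoly_zero : narayanaPoly 0 = 1 := by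
  simp [narayanaPoly, leftEdges]

theorem treesOfNumNodesEq_disjoint {n : ℕ} :
    (Finset.HasAntidiagonal.antidiagonal n : Set (ℕ × ℕ)).PairwiseDisjoint
      fun ij => pairwiseNode (treesOfNumNodesEq ij.1) (treesOfNumNodesEq ij.2) := by
  simp_rw [Set.PairwiseDisjoint, Set.Pairwise, Function.onFun, Finset.disjoint_left]
  rintro ⟨i, j⟩ _ ⟨i', j'⟩ _ hne a h1 h2
  simp only [pairwiseNode, Finset.mem_map, Finset.mem_product, Prod.exists,
    mem_treesOfNumNodesEq] at h1 h2
  obtain ⟨A, B, ⟨rfl, rfl⟩, rfl⟩ := h1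
  obtain ⟨A', B', ⟨rfl, rfl⟩, h⟩ := h2
  simp at h
  obtain ⟨rfl, rfl⟩ := h
  exact hne rfl

theorem narayanaPoly_succ (n : ℕ) :
    narayanaPoly (n + 1) = ∑ ij ∈ Finset.HasAntidiagonal.antidiagonal n,
      (if ij.1 = 0 then 1 else Polynomial.X * narayanaPoly ij.1) * narayanaPoly ij.2 := by
  rw [narayanaPoly, treesOfNumNodesEq_succ, Finset.sum_biUnion treesOfNumNodesEq_disjoint]
  refine Finset.sum_congr rfl fun ij _ => ?_
  rw [pairwiseNode, Finset.sum_map, Finset.sum_product]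
  change ∑ A ∈ treesOfNumNodesEq ij.1, ∑ B ∈ treesOfNumNodesEq ij.2,
    (Polynomial.X : Polynomial ℚ) ^ leftEdges (.node () A B) = _
  simp only [leftEdges, pow_add]
  split_ifs with h
  · rw [h]
    simp [narayanaPoly, leftEdges]
  · simp only [narayanaPoly, Finset.mul_sum, Finset.sum_mul]
    rw [Finset.sum_comm]
    refine Finset.sum_congr rfl fun B _ => Finset.sum_congr rfl fun A hA => ?_
    have : A ≠ .nil := by
      rintro rfl
      exact h (mem_treesOfNumNodesEq.1 hA).symm
    simp [this]

/-- Cutting a binary tree at its root. -/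
theorem narayanaSeries_eq :
    narayanaSeries = 1 + PowerSeries.X * (1 + ascVar * (narayanaSeries - 1)) * narayanaSeries := by
  ext1 n
  cases n with
  | zero => simp [narayanaSeries, narayanaPoly_zero]
  | succ n =>
    rw [map_add, mul_assoc, PowerSeries.coeff_succ_X_mul, PowerSeries.coeff_mul]
    simp only [narayanaSeries, PowerSeries.coeff_mk, narayanaPoly_succ, PowerSeries.coeff_one,
      Nat.add_eq_zero_iff, one_ne_zero, and_false, if_false, zero_add]
    refine Finset.sum_congr rfl fun ij _ => ?_
    congr 1
    rw [map_add, PowerSeries.coeff_C_mul, map_sub, PowerSeries.coeff_mk, PowerSeries.coeff_one]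
    split_ifs with h
    · simp [h, narayanaPoly_zero]
    · simp

/-- The square root `u = 2 x t F + x - x t - 1` of the discriminant `D` of the quadratic equation
for `F` satisfies `2 D u' = D' u`, which gives a recurrence with polynomial coefficients. -/
theorem coeff_recurrence_of_quadratic {A : Type*} [CommRing A] (t : A) (F : PowerSeries A)
    (hF : F = 1 + PowerSeries.X * (1 + PowerSeries.C t * (F - 1)) * F) (n : ℕ) :
    4 * t * (((n : A) + 4) * PowerSeries.coeff (n + 3) F) =
      4 * t * ((2 * (n : A) + 5) * (1 + t) * PowerSeries.coeff (n + 2) F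
        - ((n : A) + 1) * (1 - t) ^ 2 * PowerSeries.coeff (n + 1) F) := by
  set x : PowerSeries A := PowerSeries.X with hx
  set u : PowerSeries A := x * (PowerSeries.C (2 * t) * F + PowerSeries.C (1 - t)) - 1 with hu
  set D : PowerSeries A :=
    1 - PowerSeries.C (2 * (1 + t)) * x + PowerSeries.C ((1 - t) ^ 2) * x ^ 2 with hD
  have huD : u * u = D := by
    simp only [hu, hD, map_mul, map_add, map_sub, map_pow, map_one, map_ofNat]
    linear_combination (-4 * x * PowerSeries.C t) * hF
  set d := PowerSeries.derivative A with hd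
  have hder : 2 * (u * d u) = d D := by
    rw [← huD, Derivation.leibniz]
    simp only [smul_eq_mul]
    ring
  have hode : 2 * (D * d u) = d D * u := by
    rw [← hder, ← huD]; ring
  have hdD : d D = PowerSeries.C (-2 * (1 + t)) + PowerSeries.C (2 * (1 - t) ^ 2) * x := by
    simp only [hD, map_add, map_sub, Derivation.leibniz, hd, PowerSeries.derivative_C, hx,
      PowerSeries.derivative_X, PowerSeries.derivative_one, Derivation.leibniz_pow, smul_eq_mul,
      map_mul, map_pow, map_one, map_ofNat, map_neg]
    simp only [nsmul_eq_mul, ← map_ofNat (PowerSeries.C (R := A)), PowerSeries.derivative_C]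
    simp only [map_ofNat]
    push_cast
    ring
  have hcu : ∀ m, PowerSeries.coeff (m + 2) u = 2 * t * PowerSeries.coeff (m + 1) F := by
    intro m
    rw [hu, map_sub, hx, PowerSeries.coeff_succ_X_mul, map_add, PowerSeries.coeff_C_mul,
      PowerSeries.coeff_C, PowerSeries.coeff_one]
    simp
  have hc := congrArg (PowerSeries.coeff (n + 3)) hode
  have e1 : 2 * (D * d u) = PowerSeries.C 2 * d u - PowerSeries.C (4 * (1 + t)) * (x * d u)
      + PowerSeries.C (2 * (1 - t) ^ 2) * (x * (x * d u)) := by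
    simp only [hD, map_mul, map_add, map_sub, map_pow, map_one, map_ofNat]
    ring
  have e2 : d D * u = PowerSeries.C (-2 * (1 + t)) * u
      + PowerSeries.C (2 * (1 - t) ^ 2) * (x * u) := by
    rw [hdD]; ring
  rw [e1, e2] at hc
  simp only [map_add, map_sub, PowerSeries.coeff_C_mul, hx, PowerSeries.coeff_succ_X_mul,
    d, PowerSeries.coeff_derivative] at hc
  rw [show n + 3 + 1 = (n + 2) + 2 from rfl, show n + 2 + 1 = (n + 1) + 2 from rfl,
    show n + 1 + 1 = n + 2 from rfl, hcu, hcu, hcu] at hc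
  push_cast at hc
  linear_combination hc

theorem narayanaPoly_recurrence (n : ℕ) :
    ((n : Polynomial ℚ) + 4) * narayanaPoly (n + 3) =
      (2 * (n : Polynomial ℚ) + 5) * (1 + Polynomial.X) * narayanaPoly (n + 2)
        - ((n : Polynomial ℚ) + 1) * (1 - Polynomial.X) ^ 2 * narayanaPoly (n + 1) := by
  have h := coeff_recurrence_of_quadratic Polynomial.X narayanaSeries narayanaSeries_eq n
  have h4 : (4 : Polynomial ℚ) * Polynomial.X ≠ 0 :=
    mul_ne_zero (OfNat.ofNat_ne_zero 4) Polynomial.X_ne_zero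
  have hc : ∀ m, PowerSeries.coeff m narayanaSeries = narayanaPoly m := fun m =>
    PowerSeries.coeff_mk _ _
  rw [hc, hc, hc] at h
  exact mul_left_cancel₀ h4 h

/-! ### Narayana numbers -/

theorem cast_choose_succ (n k : ℕ) :
    (n.choose (k + 1) : ℚ) = (n.choose k : ℚ) * ((n : ℚ) - k) / (k + 1) := by
  have h := Nat.choose_succ_right_eq n k
  rw [eq_div_iff (by positivity)]
  rcases le_or_gt k n with hk | hk
  · have := congrArg (Nat.cast (R := ℚ)) h
    push_cast [Nat.cast_sub hk] at this
    exact this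
  · simp [Nat.choose_eq_zero_of_lt hk, Nat.choose_eq_zero_of_lt (Nat.lt_succ_of_lt hk)]

theorem cast_choose_succ_succ (n k : ℕ) :
    ((n + 1).choose (k + 1) : ℚ) = n.choose k + n.choose (k + 1) := by
  exact_mod_cast Nat.choose_succ_succ n k

theorem narayana_zero (n : ℕ) : narayana n 0 = 0 := by simp [narayana]

theorem narayana_succ (n k : ℕ) :
    narayana n (k + 1) = (n.choose (k + 1) : ℚ) * (n.choose k : ℚ) / n := by
  simp only [narayana, Nat.add_eq_zero_iff, one_ne_zero, and_false, if_false, Nat.add_sub_cancel]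
  ring

theorem narayana_one {n : ℕ} (hn : n ≠ 0) : narayana n 1 = 1 := by
  simp [narayana, hn]

/-- The recurrence of `narayanaPoly_recurrence` for the explicit Narayana numbers. -/
theorem narayana_recurrence (n k : ℕ) :
    ((n : ℚ) + 4) * narayana (n + 3) (k + 2) =
      (2 * n + 5) * (narayana (n + 2) (k + 2) + narayana (n + 2) (k + 1))
        - (n + 1) * (narayana (n + 1) (k + 2) - 2 * narayana (n + 1) (k + 1)
          + narayana (n + 1) k) := by
  cases k with
  | zero =>
    rw [narayana_zero, narayana_one (by omega), narayana_one (by omega), narayana_succ,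
      narayana_succ, narayana_succ]
    simp only [cast_choose_succ, Nat.choose_zero_right]
    push_cast
    field_simp
    ring
  | succ k =>
    simp only [narayana_succ, cast_choose_succ_succ (n + 2), cast_choose_succ_succ (n + 1)]
    rw [cast_choose_succ (n + 1) (k + 2), cast_choose_succ (n + 1) (k + 1),
      cast_choose_succ (n + 1) k]
    push_cast
    field_simp
    ring

theorem coeff_narayanaPoly (n k : ℕ) :
    (narayanaPoly (n + 1)).coeff k = narayana (n + 1) (k + 1) := by
  have p1 : narayanaPoly 1 = 1 := by
    rw [narayanaPoly_succ]; simp [narayanaPoly_zero]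
  have p2 : narayanaPoly 2 = 1 + Polynomial.X := by
    rw [narayanaPoly_succ, Finset.Nat.antidiagonal_succ]; simp [narayanaPoly_zero, p1]
  induction n using Nat.strong_induction_on generalizing k with
  | _ n ih =>
    match n with
    | 0 =>
      rw [p1, narayana_succ, Polynomial.coeff_one]
      rcases k with _ | k
      · simp
      · simp [Nat.choose_eq_zero_of_lt]
    | 1 =>
      rw [p2, narayana_succ, Polynomial.coeff_add, Polynomial.coeff_one, Polynomial.coeff_X]
      rcases k with _ | _ | k
      · norm_num
      · norm_num
      · simp [Nat.choose_eq_zero_of_lt]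
    | n + 2 =>
      have h := congrArg (fun p => Polynomial.coeff p k) (narayanaPoly_recurrence n)
      have e1 : ((n : Polynomial ℚ) + 4) = Polynomial.C ((n : ℚ) + 4) := by
        simp only [map_add, map_natCast, map_ofNat]
      have e2 : (2 * (n : Polynomial ℚ) + 5) * (1 + Polynomial.X) * narayanaPoly (n + 2) =
          Polynomial.C (2 * (n : ℚ) + 5) *
            (narayanaPoly (n + 2) + Polynomial.X * narayanaPoly (n + 2)) := by
        simp only [map_add, map_mul, map_natCast, map_ofNat]; ring
      have e3 : ((n : Polynomial ℚ) + 1) * (1 - Polynomial.X) ^ 2 * narayanaPoly (n + 1) =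
          Polynomial.C ((n : ℚ) + 1) * (narayanaPoly (n + 1) -
            Polynomial.C 2 * (Polynomial.X * narayanaPoly (n + 1)) +
            Polynomial.X * (Polynomial.X * narayanaPoly (n + 1))) := by
        simp only [map_add, map_natCast, map_ofNat, map_one]; ring
      rw [e1, e2, e3] at h
      simp only [Polynomial.coeff_sub, Polynomial.coeff_add, Polynomial.coeff_C_mul] at h
      have hne : (n : ℚ) + 4 ≠ 0 := by positivity
      apply mul_left_cancel₀ hne
      rw [h]
      rcases k with _ | _ | k
      · simp only [Polynomial.mul_coeff_zero, Polynomial.coeff_X_zero, zero_mul]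
        rw [ih (n + 1) (by omega), ih n (by omega), narayana_one (by omega),
          narayana_one (by omega), narayana_one (by omega)]
        ring
      · simp only [Polynomial.coeff_X_mul, Polynomial.mul_coeff_zero, Polynomial.coeff_X_zero,
          zero_mul, zero_add]
        simp only [ih (n + 1) (by omega), ih n (by omega)]
        rw [narayana_recurrence n 0, narayana_zero]
      · simp only [Polynomial.coeff_X_mul]
        simp only [ih (n + 1) (by omega), ih n (by omega)]
        rw [narayana_recurrence n (k + 1)]

/-! ### Extensions of 021-avoiding ascent sequences -/

/-- The largest letter of a word, `0` for the empty word. -/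
def maxLetter (p : List ℕ) : ℕ := p.foldr max 0

theorem maxLetter_snoc (p : List ℕ) (b : ℕ) : maxLetter (p ++ [b]) = max (maxLetter p) b := by
  induction p with
  | nil => simp [maxLetter]
  | cons c p ih =>
    simp only [maxLetter, List.cons_append, List.foldr_cons] at ih ⊢
    rw [ih, max_assoc]

theorem maxLetter_le {p : List ℕ} {b : ℕ} : maxLetter p ≤ b ↔ ∀ c ∈ p, c ≤ b := by
  induction p with
  | nil => simp [maxLetter]
  | cons c p ih =>
    simp only [maxLetter, List.foldr_cons, max_le_iff, List.forall_mem_cons] at ih ⊢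
    rw [ih]

/-- The letters that may follow a nonempty prefix `p` in a 021-avoiding ascent sequence: since the
first letter is `0`, avoiding 021 means that the nonzero letters increase weakly. -/
def nextLetters (p : List ℕ) : Finset ℕ :=
  insert 0 (Finset.Icc (max (maxLetter p) 1) (asc p + 1))

/-- The words `q` of length `n` for which `p ++ q` is a 021-avoiding ascent sequence, where `p` is a
nonempty 021-avoiding ascent sequence. -/
def extensions : List ℕ → ℕ → Finset (List ℕ)
  | _, 0 => {[]}
  | p, n + 1 => (nextLetters p).biUnion fun b => (extensions (p ++ [b]) n).image (b :: ·)

theorem append_singleton_mem_avoiding_iff {p : List ℕ} {b : ℕ} (hne : p ≠ [])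
    (hp : IsAscentSeq p) (hav : ¬ ContainsPattern [0, 2, 1] p) :
    IsAscentSeq (p ++ [b]) ∧ ¬ ContainsPattern [0, 2, 1] (p ++ [b]) ↔ b ∈ nextLetters p := by
  rw [isAscentSeq_snoc, if_neg hne, nextLetters, Finset.mem_insert, Finset.mem_Icc, max_le_iff,
    maxLetter_le]
  rw [containsPattern_021] at hav ⊢
  constructor
  · rintro ⟨⟨-, hb⟩, hpb⟩
    by_cases hb0 : b = 0
    · exact .inl hb0
    refine .inr ⟨⟨fun c hc => ?_, by omega⟩, hb⟩
    by_contra hcb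
    obtain ⟨d, p', rfl⟩ := List.exists_cons_of_ne_nil hne
    have hd : d = 0 := by simpa using hp.getD_zero
    have hc' : c ∈ p' := by
      rcases List.mem_cons.1 hc with rfl | h
      · omega
      · exact h
    refine hpb ⟨d, c, b, ?_, by omega, by omega⟩
    exact ((List.singleton_sublist.2 hc').cons_cons d).append (List.Sublist.refl [b])
  · intro hb
    refine ⟨⟨hp, by omega⟩, ?_⟩
    rintro ⟨x, y, z, hs, hxz, hzy⟩
    obtain ⟨l₁, l₂, hl, h₁, h₂⟩ := List.sublist_append_iff.1 hs
    rcases List.sublist_singleton.1 h₂ with rfl | rfl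
    · rw [List.append_nil] at hl
      subst hl
      exact hav ⟨x, y, z, h₁, hxz, hzy⟩
    · have hl' : [x, y] ++ [z] = l₁ ++ [b] := hl
      obtain ⟨rfl, h⟩ := List.append_inj' hl' rfl
      simp only [List.cons.injEq, and_true] at h
      subst h
      rcases hb with hb | hb
      · omega
      · have := hb.1.1 y (h₁.subset (by simp))
        omega

theorem prefix_avoiding {p q : List ℕ}
    (h : IsAscentSeq (p ++ q) ∧ ¬ ContainsPattern [0, 2, 1] (p ++ q)) :
    IsAscentSeq p ∧ ¬ ContainsPattern [0, 2, 1] p := by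
  refine ⟨by simpa using h.1.take p.length, fun hc => h.2 ?_⟩
  rw [containsPattern_021] at hc ⊢
  obtain ⟨x, y, z, hs, h⟩ := hc
  exact ⟨x, y, z, hs.trans (List.sublist_append_left p q), h⟩

theorem mem_extensions {p : List ℕ} (n : ℕ) (hne : p ≠ [])
    (hp : IsAscentSeq p ∧ ¬ ContainsPattern [0, 2, 1] p) {q : List ℕ} :
    q ∈ extensions p n ↔
      q.length = n ∧ IsAscentSeq (p ++ q) ∧ ¬ ContainsPattern [0, 2, 1] (p ++ q) := by
  induction n generalizing p q with
  | zero =>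
    simp only [extensions, Finset.mem_singleton, List.length_eq_zero_iff]
    constructor
    · rintro rfl
      simpa using hp
    · exact fun h => h.1
  | succ n ih =>
    simp only [extensions, Finset.mem_biUnion, Finset.mem_image]
    constructor
    · rintro ⟨b, hb, q, hq, rfl⟩
      have hpb := (append_singleton_mem_avoiding_iff hne hp.1 hp.2).2 hb
      rw [ih (by simp) hpb] at hq
      simpa using hq
    · rintro ⟨hlen, h⟩
      cases q with
      | nil => simp at hlen
      | cons b q =>
        rw [List.append_cons] at h
        have hpb := prefix_avoiding h
        refine ⟨b, (append_singleton_mem_avoiding_iff hne hp.1 hp.2).1 hpb, q, ?_, rfl⟩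
        rw [ih (by simp) hpb]
        exact ⟨by simpa using hlen, h⟩

/-- The polynomial `∑ t ^ asc (p ++ q)` over the extensions `q` of `p` by `n` letters. -/
noncomputable def extensionPoly (p : List ℕ) (n : ℕ) : Polynomial ℚ :=
  ∑ q ∈ extensions p n, Polynomial.X ^ asc (p ++ q)

theorem extensionPoly_zero (p : List ℕ) : extensionPoly p 0 = Polynomial.X ^ asc p := by
  simp [extensionPoly, extensions]

theorem extensionPoly_succ (p : List ℕ) (n : ℕ) :
    extensionPoly p (n + 1) = ∑ b ∈ nextLetters p, extensionPoly (p ++ [b]) n := by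
  rw [extensionPoly, extensions, Finset.sum_biUnion]
  · refine Finset.sum_congr rfl fun b _ => ?_
    rw [Finset.sum_image fun q _ q' _ h => (List.cons.inj h).2]
    simp [extensionPoly]
  · intro b _ b' _ hbb'
    rw [Function.onFun, Finset.disjoint_left]
    intro q hq hq'
    obtain ⟨_, _, rfl⟩ := Finset.mem_image.1 hq
    obtain ⟨_, _, h⟩ := Finset.mem_image.1 hq'
    exact hbb' (List.cons.inj h).1.symm

theorem sum_Icc_eq_sum_range_sub {M : Type*} [AddCommMonoid M] (f : ℕ → M) (m s : ℕ) :
    ∑ b ∈ Finset.Icc m (m + s), f b = ∑ j ∈ Finset.range (s + 1), f (m + s - j) := by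
  refine Finset.sum_nbij' (fun b => m + s - b) (fun j => m + s - j) ?_ ?_ ?_ ?_ ?_
  · intro b hb; simp at hb ⊢; omega
  · intro j hj; simp at hj ⊢; omega
  · intro b hb; simp at hb; omega
  · intro j hj; simp at hj; omega
  · intro b hb; simp at hb; congr 1; omega

/-! ### The generating function of extensions -/

/-- The series `F (1 + t (F - 1)) = (F - 1) / x`. -/
noncomputable def shiftedSeries : PowerSeries (Polynomial ℚ) :=
  narayanaSeries * (1 + ascVar * (narayanaSeries - 1))

/-- The factor `(1 - x) (F - 1) / x` by which the generating function of the extensions of a word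
grows when its slack, the difference between `asc + 1` and the largest letter, grows by `1`. -/
noncomputable def slackSeries : PowerSeries (Polynomial ℚ) :=
  (1 - PowerSeries.X) * shiftedSeries

theorem narayanaSeries_eq_one_add :
    narayanaSeries = 1 + PowerSeries.X * shiftedSeries := by
  rw [shiftedSeries]
  linear_combination narayanaSeries_eq

theorem slackSeries_sub_one :
    slackSeries - 1 = PowerSeries.X * (ascVar * (shiftedSeries * narayanaSeries)) := by
  have h := narayanaSeries_eq_one_add
  have h' : shiftedSeries = narayanaSeries * (1 + ascVar * (narayanaSeries - 1)) := rfl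
  rw [slackSeries]
  linear_combination h' + h + (ascVar * narayanaSeries) * h

theorem slackSeries_pow_succ (s : ℕ) :
    slackSeries ^ (s + 1) = 1 + PowerSeries.X * (ascVar *
      ∑ j ∈ Finset.range (s + 1), shiftedSeries * narayanaSeries * slackSeries ^ j) := by
  have h := mul_geom_sum slackSeries (s + 1)
  rw [slackSeries_sub_one] at h
  rw [← Finset.mul_sum]
  linear_combination -h

/-- The recursion for extensions after a zero: the next letter is either `0`, or it is nonzero and
creates an ascent. -/
theorem coeff_succ_shiftedSeries (n s : ℕ) :
    PowerSeries.coeff (n + 1) (shiftedSeries * slackSeries ^ s) =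
      PowerSeries.coeff n (shiftedSeries * slackSeries ^ s) + Polynomial.X *
        ∑ j ∈ Finset.range (s + 1),
          PowerSeries.coeff n (shiftedSeries * narayanaSeries * slackSeries ^ j) := by
  have h : shiftedSeries * slackSeries ^ s =
      1 + PowerSeries.X * (shiftedSeries * slackSeries ^ s + ascVar *
        ∑ j ∈ Finset.range (s + 1), shiftedSeries * narayanaSeries * slackSeries ^ j) := by
    have h1 := slackSeries_pow_succ s
    have h2 : slackSeries = (1 - PowerSeries.X) * shiftedSeries := rfl
    linear_combination h1 - slackSeries ^ s * h2
  conv_lhs => rw [h]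
  rw [map_add, PowerSeries.coeff_succ_X_mul, map_add, PowerSeries.coeff_C_mul, map_sum,
    PowerSeries.coeff_one]
  simp

/-- The recursion for extensions after a nonzero letter: the next letter is `0`, or it repeats the
last letter, or it is larger and creates an ascent. -/
theorem coeff_succ_shiftedSeries_mul (n s : ℕ) :
    PowerSeries.coeff (n + 1) (shiftedSeries * narayanaSeries * slackSeries ^ s) =
      PowerSeries.coeff n (shiftedSeries * slackSeries ^ (s + 1)) +
      PowerSeries.coeff n (shiftedSeries * narayanaSeries * slackSeries ^ s) + Polynomial.X *
        ∑ j ∈ Finset.range (s + 1),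
          PowerSeries.coeff n (shiftedSeries * narayanaSeries * slackSeries ^ j) := by
  have h : shiftedSeries * narayanaSeries * slackSeries ^ s =
      1 + PowerSeries.X * (shiftedSeries * slackSeries ^ (s + 1) +
        shiftedSeries * narayanaSeries * slackSeries ^ s + ascVar *
        ∑ j ∈ Finset.range (s + 1), shiftedSeries * narayanaSeries * slackSeries ^ j) := by
    have h1 := slackSeries_pow_succ s
    have h2 : slackSeries = (1 - PowerSeries.X) * shiftedSeries := rfl
    linear_combination h1 - slackSeries ^ s * narayanaSeries * h2
      + slackSeries ^ (s + 1) * narayanaSeries_eq_one_add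
  conv_lhs => rw [h]
  rw [map_add, PowerSeries.coeff_succ_X_mul, map_add, map_add, PowerSeries.coeff_C_mul, map_sum,
    PowerSeries.coeff_one]
  simp

theorem constantCoeff_narayanaSeries : PowerSeries.constantCoeff narayanaSeries = 1 := by
  rw [narayanaSeries_eq_one_add]; simp

theorem constantCoeff_shiftedSeries : PowerSeries.constantCoeff shiftedSeries = 1 := by
  simp [shiftedSeries, constantCoeff_narayanaSeries]

theorem constantCoeff_slackSeries : PowerSeries.constantCoeff slackSeries = 1 := by
  simp [slackSeries, constantCoeff_shiftedSeries]

/-- The extensions of a word ending in `c` depend only on whether `c` is zero and on the slack,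
which is `s` in the first case and `s + 1` in the second. In the first case the largest letter is
replaced by `1` if it is `0`, because a nonzero next letter is at least `1`. -/
theorem extensionPoly_eq (n : ℕ) :
    (∀ y s, asc (y ++ [0]) + 1 = max (maxLetter y) 1 + s →
      extensionPoly (y ++ [0]) n = Polynomial.X ^ asc (y ++ [0]) *
        PowerSeries.coeff n (shiftedSeries * slackSeries ^ s)) ∧
    (∀ y c s, 0 < c → maxLetter y ≤ c → asc (y ++ [c]) = c + s →
      extensionPoly (y ++ [c]) n = Polynomial.X ^ asc (y ++ [c]) *
        PowerSeries.coeff n (shiftedSeries * narayanaSeries * slackSeries ^ s)) := by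
  induction n with
  | zero =>
    simp [extensionPoly_zero, constantCoeff_shiftedSeries, constantCoeff_slackSeries,
      constantCoeff_narayanaSeries]
  | succ n ih =>
    obtain ⟨ihZ, ihN⟩ := ih
    -- A new letter `b` that exceeds the last letter creates an ascent.
    have key : ∀ y c m s, c < m → maxLetter (y ++ [c]) ≤ m → asc (y ++ [c]) + 1 = m + s →
        ∑ b ∈ Finset.Icc m (m + s), extensionPoly (y ++ [c] ++ [b]) n =
          Polynomial.X ^ asc (y ++ [c]) * (Polynomial.X * ∑ j ∈ Finset.range (s + 1),
            PowerSeries.coeff n (shiftedSeries * narayanaSeries * slackSeries ^ j)) := by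
      intro y c m s hcm hm ha
      rw [sum_Icc_eq_sum_range_sub, Finset.mul_sum, Finset.mul_sum]
      refine Finset.sum_congr rfl fun j hj => ?_
      have hj := Finset.mem_range.1 hj
      have hasc : asc (y ++ [c] ++ [m + s - j]) = asc (y ++ [c]) + 1 := by
        rw [asc_snoc, if_pos (by omega)]
      rw [ihN _ _ j (by omega) (by omega) (by omega), hasc, pow_succ, mul_assoc]
    have hnot : ∀ m a : ℕ, 0 ∉ Finset.Icc (max m 1) a := fun m a h => by
      have := (Finset.mem_Icc.1 h).1
      omega
    constructor
    · intro y s hs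
      have hM : maxLetter (y ++ [0]) = maxLetter y := by rw [maxLetter_snoc]; simp
      have h0 : asc (y ++ [0] ++ [0]) = asc (y ++ [0]) := by rw [asc_snoc]; simp
      rw [extensionPoly_succ, nextLetters, Finset.sum_insert (hnot _ _), hs, hM,
        key _ _ _ s (by omega) (by omega) hs,
        ihZ _ s (by rw [h0, hM, hs]), h0, coeff_succ_shiftedSeries, mul_add]
    · intro y c s hc hyc hs
      have hM : maxLetter (y ++ [c]) = c := by rw [maxLetter_snoc, max_eq_right hyc]
      have h0 : asc (y ++ [c] ++ [0]) = asc (y ++ [c]) := by rw [asc_snoc]; simp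
      have h1 : asc (y ++ [c] ++ [c]) = asc (y ++ [c]) := by rw [asc_snoc]; simp
      have hI : Finset.Icc (max c 1) (asc (y ++ [c]) + 1) =
          insert c (Finset.Icc (c + 1) (c + 1 + s)) := by
        ext b
        simp only [Finset.mem_Icc, Finset.mem_insert]
        omega
      rw [extensionPoly_succ, nextLetters, Finset.sum_insert (hnot _ _), hM, hI,
        Finset.sum_insert (by simp), key _ _ _ s (by omega) (by omega) (by omega),
        ihZ _ (s + 1) (by rw [h0, hM]; omega), ihN _ c s hc hM.le (by rw [h1, hs]), h0, h1,
        coeff_succ_shiftedSeries_mul]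
      ring

theorem extensionPoly_zero_word (n : ℕ) : extensionPoly [0] n = narayanaPoly (n + 1) := by
  have h := (extensionPoly_eq n).1 [] 0 (by simp [asc, maxLetter])
  have h' : PowerSeries.coeff (n + 1) narayanaSeries = narayanaPoly (n + 1) :=
    PowerSeries.coeff_mk _ _
  rw [narayanaSeries_eq_one_add, map_add, PowerSeries.coeff_succ_X_mul, PowerSeries.coeff_one] at h'
  simpa [asc] using h.trans (by simpa [asc] using h')

/-! ### Counting by ascents -/

theorem coeff_sum_X_pow {α : Type*} (S : Finset α) (f : α → ℕ) (k : ℕ) :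
    (∑ a ∈ S, (Polynomial.X : Polynomial ℚ) ^ f a).coeff k = (S.filter (f · = k)).card := by
  simp only [Polynomial.finsetSum_coeff, Polynomial.coeff_X_pow, Finset.sum_boole, eq_comm]

theorem ncard_restrictedAscentSeqs (n k : ℕ) :
    (({x ∈ restrictedAscentSeqs n | asc x = k}.ncard : ℕ) : ℚ) = (narayanaPoly n).coeff k := by
  have h : {x ∈ restrictedAscentSeqs n | asc x = k} =
      treeSeq '' ((treesOfNumNodesEq n).filter (leftEdges · = k) : Finset _) := by
    ext x
    simp only [Set.mem_ofPred_eq, ← (bijOn_treeSeq n).image_eq, Set.mem_image, Finset.coe_filter,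
      mem_treesOfNumNodesEq]
    constructor
    · rintro ⟨⟨t, ht, rfl⟩, hk⟩
      exact ⟨t, ⟨ht, by rw [← hk, (treeSeq_spec t).2.2.1]⟩, rfl⟩
    · rintro ⟨t, ⟨ht, hk⟩, rfl⟩
      exact ⟨⟨t, ht, rfl⟩, by rw [← hk, (treeSeq_spec t).2.2.1]⟩
  rw [h, Set.ncard_image_of_injective _ treeSeq_injective, Set.ncard_coe_finset, narayanaPoly,
    coeff_sum_X_pow]

theorem ncard_ascentSeqsAvoiding_021 (n k : ℕ) :
    (({x ∈ ascentSeqsAvoiding [0, 2, 1] (n + 1) | asc x = k}.ncard : ℕ) : ℚ) =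
      (narayanaPoly (n + 1)).coeff k := by
  have h0 : IsAscentSeq [0] ∧ ¬ ContainsPattern [0, 2, 1] [0] := by
    refine ⟨(isRestrictedAscentSeq_replicate_zero 1).1, ?_⟩
    rw [containsPattern_021]
    rintro ⟨a, b, c, hs, -⟩
    simpa using hs.length_le
  have h : {x ∈ ascentSeqsAvoiding [0, 2, 1] (n + 1) | asc x = k} =
      List.cons 0 '' ((extensions [0] n).filter (fun q => asc ([0] ++ q) = k) : Finset _) := by
    ext x
    simp only [ascentSeqsAvoiding, Set.mem_ofPred_eq, Set.mem_image, Finset.coe_filter,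
      mem_extensions n (List.cons_ne_nil 0 []) h0]
    constructor
    · rintro ⟨⟨hlen, hx⟩, hk⟩
      cases x with
      | nil => simp at hlen
      | cons a q =>
        have ha : a = 0 := by simpa using hx.1.getD_zero
        subst ha
        exact ⟨q, ⟨⟨by simpa using hlen, hx⟩, hk⟩, rfl⟩
    · rintro ⟨q, ⟨⟨hlen, hx⟩, hk⟩, rfl⟩
      exact ⟨⟨by simpa using hlen, hx⟩, hk⟩
  rw [h, Set.ncard_image_of_injective _ (List.cons_injective), Set.ncard_coe_finset,
    ← extensionPoly_zero_word, extensionPoly, coeff_sum_X_pow]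

theorem mainTheorem3 (n : ℕ) :
    Set.BijOn phi (restrictedAscentSeqs n) (permsAvoiding [2, 3, 1] n) ∧
    (∀ x ∈ restrictedAscentSeqs n, asc x = des (phi x)) ∧
    (1 ≤ n → ∀ k : ℕ,
      (({x ∈ ascentSeqsAvoiding [0, 2, 1] n | asc x = k}.ncard : ℕ) : ℚ) = narayana n (k + 1) ∧
      (({x ∈ restrictedAscentSeqs n | asc x = k}.ncard : ℕ) : ℚ) = narayana n (k + 1)) := by
  refine ⟨bijOn_phi n, fun x hx => asc_eq_des_phi hx.2, fun hn k => ?_⟩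
  obtain ⟨n, rfl⟩ := Nat.exists_eq_add_of_le' hn
  rw [ncard_ascentSeqsAvoiding_021, ncard_restrictedAscentSeqs, coeff_narayanaPoly]
  exact ⟨rfl, rfl⟩
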